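/- Let $n$ be a natural number and identify $\mathbb{T}^n$ with $[0,1)^n$. For $\varphi\in L^2(\mathbb{R}^{2n})$ and $k,l\in\mathbb{Z}^n$ define the twisted translation $$T^t_{(k,l)}\varphi(x,y)=e^{\pi i(x\cdot l-y\cdot k)}\varphi(x-k,y-l),\qquad x,y\in\mathbb{R}^n,$$ and let $V^t(\varphi)$ be the closed linear span of $\{T^t_{(k,l)}\varphi : k,l\in\mathbb{Z}^n\}$ in $L^2(\mathbb{R}^{2n})$. Let $\varphi\mapsto K_\varphi$ be the isometry of $L^2(\mathbb{R}^{2n})$ that extends by continuity the integral formula $$K_\varphi(\xi,\eta)=\int_{\mathbb{R}^n}\varphi(x,\eta-\xi)\,e^{\pi i x\cdot(\xi+\eta)}\,dx$$ from Schwartz functions ($K_\varphi$ is the kernel of the Weyl transform of $\varphi$). The Weyl-Zak transform of $\varphi$ is $$Z_W\varphi(\xi,\xi',\eta)=\sum_{m\in\mathbb{Z}^n}K_\varphi(m+\xi,\eta)\,e^{-2\pi i m\cdot\xi'},\qquad \xi,\xi'\in\mathbb{T}^n,\ \eta\in\mathbb{R}^n,$$ with convergence in $L^2(\mathbb{T}^n\times\mathbb{T}^n\times\mathbb{R}^n)$.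 Put $\mathcal{J}\varphi(\xi,\xi')=Z_W\varphi(\xi,\xi',\cdot)\in L^2(\mathbb{R}^n)$ for a.e. $(\xi,\xi')$, and $$[\varphi,\psi](\xi,\xi')=\int_{\mathbb{R}^n}Z_W\varphi(\xi,\xi',\eta)\,\overline{Z_W\psi(\xi,\xi',\eta)}\,d\eta,\qquad \Omega_\varphi=\{(\xi,\xi')\in\mathbb{T}^n\times\mathbb{T}^n : [\varphi,\varphi](\xi,\xi')\neq 0\}.$$ **Lemma.** Let $\varphi\in L^2(\mathbb{R}^{2n})$. There is exactly one $\psi\in L^2(\mathbb{R}^{2n})$ such that, for a.e. $(\xi,\xi')\in\mathbb{T}^n\times\mathbb{T}^n$, $$\mathcal{J}\psi(\xi,\xi')=\begin{cases}\dfrac{\mathcal{J}\varphi(\xi,\xi')}{\sqrt{[\varphi,\varphi](\xi,\xi')}} & \text{if }(\xi,\xi')\in\Omega_\varphi,\\[2mm] 0 & \text{otherwise.}\end{cases}$$ For this $\psi$, the system $\{T^t_{(k,l)}\psi : k,l\in\mathbb{Z}^n\}$ is a Parseval frame for $V^t(\varphi)$; that is, all $T^t_{(k,l)}\psi$ lie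 in $V^t(\varphi)$ and $$\sum_{k,l\in\mathbb{Z}^n}|\langle f,T^t_{(k,l)}\psi\rangle|^2=\|f\|^2\qquad\text{for all } f\in V^t(\varphi).$$ Moreover $V^t(\varphi)=V^t(\psi)$. -/

import Mathlib

open MeasureTheory
open scoped ENNReal SchwartzMap FourierTransform

noncomputable section

namespace TwistedShift

/-! ### Spaces -/

/-- The space `ℝⁿ`. -/
abbrev E (n : ℕ) : Type := EuclideanSpace ℝ (Fin n)

/-- The Hilbert space `L²(ℝ²ⁿ)`, where `ℝ²ⁿ = ℝⁿ × ℝⁿ` carries Lebesgue measure. -/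
abbrev L2 (n : ℕ) : Type := Lp ℂ 2 (volume : Measure (E n × E n))

/-- A point of `ℤⁿ`, regarded as a point of `ℝⁿ`. -/
def intVec {n : ℕ} (k : Fin n → ℤ) : E n := WithLp.toLp 2 fun i => (k i : ℝ)

/-- The fundamental domain `[0,1)ⁿ`, which represents the torus `𝕋ⁿ`. -/
def cube (n : ℕ) : Set (E n) := {ξ | ∀ i, 0 ≤ ξ i ∧ ξ i < 1}

/-- Lebesgue measure on `𝕋ⁿ = [0,1)ⁿ`. -/
def torusMeasure (n : ℕ) : Measure (E n) := volume.restrict (cube n)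

/-- The product measure on `𝕋ⁿ × 𝕋ⁿ`. -/
def torusMeasure₂ (n : ℕ) : Measure (E n × E n) := (torusMeasure n).prod (torusMeasure n)

/-- The product measure on `(𝕋ⁿ × 𝕋ⁿ) × ℝⁿ`. -/
def zakMeasure (n : ℕ) : Measure ((E n × E n) × E n) := (torusMeasure₂ n).prod volume

theorem volume_cube (n : ℕ) : volume (cube n) = 1 := by
  have h := (EuclideanSpace.volume_preserving_symm_measurableEquiv_toLp (Fin n)).symm
  have hs : MeasurableSet (Set.univ.pi fun _ : Fin n => Set.Ico (0 : ℝ) 1) :=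
    MeasurableSet.univ_pi fun _ => measurableSet_Ico
  have h2 : cube n = (WithLp.ofLp : E n → Fin n → ℝ) ⁻¹'
      (Set.univ.pi fun _ : Fin n => Set.Ico (0 : ℝ) 1) := by
    ext x; simp [cube]
  rw [h2, (PiLp.volume_preserving_ofLp (Fin n)).measure_preimage hs.nullMeasurableSet,
    Real.volume_pi_Ico]
  simp

instance (n : ℕ) : IsProbabilityMeasure (torusMeasure n) :=
  ⟨by simp [torusMeasure, volume_cube]⟩

instance (n : ℕ) : IsProbabilityMeasure (torusMeasure₂ n) := by
  unfold torusMeasure₂; infer_instance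

instance (n : ℕ) : (volume : Measure (E n × E n)).IsAddHaarMeasure :=
  inferInstanceAs (((volume : Measure (E n)).prod volume).IsAddHaarMeasure)

instance (n : ℕ) : (volume : Measure (E n × E n)).HasTemperateGrowth :=
  inferInstance

/-! ### Twisted translations and principal twisted shift-invariant spaces -/

/-- `e^{πi(x·l - y·k)} f(x - k, y - l)`. -/
def twistedTranslateFun {n : ℕ} (k l : Fin n → ℤ) (f : E n × E n → ℂ) (p : E n × E n) : ℂ :=
  Complex.exp (Real.pi * Complex.I *
      ((inner ℝ p.1 (intVec l) - inner ℝ p.2 (intVec k) : ℝ) : ℂ)) *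
    f (p.1 - intVec k, p.2 - intVec l)

theorem norm_exp_pi_mul (t : ℝ) : ‖Complex.exp (Real.pi * Complex.I * (t : ℂ))‖ = 1 := by
  have : (Real.pi * Complex.I * (t : ℂ)) = ((Real.pi * t : ℝ) : ℂ) * Complex.I := by
    push_cast; ring
  rw [this, Complex.norm_exp_ofReal_mul_I]

theorem memLp_twistedTranslateFun {n : ℕ} (k l : Fin n → ℤ) (φ : L2 n) :
    MemLp (twistedTranslateFun k l φ) 2 (volume : Measure (E n × E n)) := by
  have hmp : MeasurePreserving (fun p : E n × E n => (p.1 - intVec k, p.2 - intVec l))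
      volume volume := measurePreserving_sub_right volume (intVec k, intVec l)
  have h := (Lp.memLp φ).comp_measurePreserving hmp
  refine h.of_le (f := twistedTranslateFun k l φ) (AEStronglyMeasurable.mul ?_ h.1) ?_
  · exact Continuous.aestronglyMeasurable (by fun_prop)
  · refine Filter.Eventually.of_forall fun p => ?_
    simp only [twistedTranslateFun, norm_mul, norm_exp_pi_mul, one_mul]
    rfl

/-- The twisted translation `T^t_{(k,l)} φ(x,y) = e^{πi(x·l - y·k)} φ(x - k, y - l)`. -/
def twistedTranslate {n : ℕ} (k l : Fin n → ℤ) (φ : L2 n) : L2 n :=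
  (memLp_twistedTranslateFun k l φ).toLp

/-- The system `E^t(φ) = {T^t_{(k,l)} φ : k, l ∈ ℤⁿ}`. -/
def twistedSystem {n : ℕ} (φ : L2 n) (kl : (Fin n → ℤ) × (Fin n → ℤ)) : L2 n :=
  twistedTranslate kl.1 kl.2 φ

/-- `V^t(φ)`, the closed linear span of `E^t(φ)`. -/
def principalSpace {n : ℕ} (φ : L2 n) : Submodule ℂ (L2 n) :=
  (Submodule.span ℂ (Set.range (twistedSystem φ))).topologicalClosure

/-- The family `e` is a Parseval frame for the subspace `V`: it lies in `V` and
`∑ |⟨f, e i⟩|² = ‖f‖²` for all `f ∈ V`. -/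
def IsParsevalFrameFor {ι H : Type*} [NormedAddCommGroup H] [InnerProductSpace ℂ H]
    (V : Submodule ℂ H) (e : ι → H) : Prop :=
  (∀ i, e i ∈ V) ∧ ∀ f ∈ V, HasSum (fun i => ‖inner ℂ f (e i)‖ ^ 2) (‖f‖ ^ 2)

/-! ### The kernel of the Weyl transform -/

/-- `K_g(ξ,η) = ∫ g(x, η - ξ) e^{πi x·(ξ+η)} dx`. -/
def weylKernelFun {n : ℕ} (g : E n × E n → ℂ) (p : E n × E n) : ℂ :=
  ∫ x : E n, g (x, p.2 - p.1) *
    Complex.exp (Real.pi * Complex.I * ((inner ℝ x (p.1 + p.2) : ℝ) : ℂ))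

/-- `x ↦ g(x, y)` as a Schwartz function. -/
def slice {n : ℕ} (g : 𝓢(E n × E n, ℂ)) (y : E n) : 𝓢(E n, ℂ) :=
  SchwartzMap.compCLM ℂ (g := fun x : E n => (x, y))
    (by
      have h1 : (fun x : E n => ((ContinuousLinearMap.inl ℝ (E n) (E n)) x : E n × E n)
          + ((0 : E n), y)).HasTemperateGrowth :=
        (ContinuousLinearMap.hasTemperateGrowth _).add (Function.HasTemperateGrowth.const _)
      simpa using h1)
    ⟨1, 1, fun x => by
      have : ‖x‖ ≤ ‖((x, y) : E n × E n)‖ := le_max_left _ _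
      simp only [pow_one, one_mul]; linarith⟩ g

theorem slice_apply {n : ℕ} (g : 𝓢(E n × E n, ℂ)) (y x : E n) : slice g y x = g (x, y) := rfl

theorem weylKernelFun_eq {n : ℕ} (g : 𝓢(E n × E n, ℂ)) (p : E n × E n) :
    weylKernelFun g p = 𝓕⁻ (slice g (p.2 - p.1)) ((1 / 2 : ℝ) • (p.1 + p.2)) := by
  rw [SchwartzMap.fourierInv_coe, Real.fourierInv_eq']
  unfold weylKernelFun
  congr 1
  ext x
  rw [smul_eq_mul, mul_comm, slice_apply, inner_smul_right]
  congr 2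
  push_cast
  ring

/-- `(ξ,η) ↦ ((ξ+η)/2, η-ξ)`. -/
def midDiff (n : ℕ) (p : E n × E n) : E n × E n := ((1 / 2 : ℝ) • (p.1 + p.2), p.2 - p.1)

theorem measurePreserving_midDiff (n : ℕ) :
    MeasurePreserving (midDiff n) volume volume := by
  have h1 : MeasurePreserving (fun p : E n × E n => (p.1, p.2 - p.1)) volume volume :=
    MeasurePreserving.skew_product (f := id) (g := fun a b => b - a)
      (MeasurePreserving.id _) (by fun_prop)
      (Filter.Eventually.of_forall fun a => (measurePreserving_sub_right volume a).map_eq)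
  have h2 : MeasurePreserving (fun p : E n × E n => (p.1, p.2 + (1 / 2 : ℝ) • p.1))
      volume volume :=
    MeasurePreserving.skew_product (f := id) (g := fun a b => b + (1 / 2 : ℝ) • a)
      (MeasurePreserving.id _) (by fun_prop)
      (Filter.Eventually.of_forall fun a =>
        (measurePreserving_add_right volume ((1 / 2 : ℝ) • a)).map_eq)
  have hs : MeasurePreserving (Prod.swap : E n × E n → E n × E n) volume volume :=
    Measure.measurePreserving_swap
  have h := hs.comp (h2.comp (hs.comp h1))
  convert h using 1
  ext p : 1
  refine Prod.ext ?_ rfl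
  simp only [midDiff, Function.comp, Prod.swap]
  module

/-- `(w,y) ↦ 𝓕⁻(g(·,y))(w)`. -/
def partialFourierInv {n : ℕ} (g : 𝓢(E n × E n, ℂ)) (q : E n × E n) : ℂ :=
  𝓕⁻ (slice g q.2) q.1

theorem stronglyMeasurable_partialFourierInv {n : ℕ} (g : 𝓢(E n × E n, ℂ)) :
    StronglyMeasurable (partialFourierInv g) := by
  have h : partialFourierInv g = fun q : E n × E n => ∫ x : E n,
      Complex.exp (((2 * Real.pi * inner ℝ x q.1 : ℝ) : ℂ) * Complex.I) • g (x, q.2) := by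
    ext q
    rw [partialFourierInv, SchwartzMap.fourierInv_coe, Real.fourierInv_eq']
    rfl
  rw [h]
  refine StronglyMeasurable.integral_prod_right (f := fun (q : E n × E n) (x : E n) =>
    Complex.exp (((2 * Real.pi * inner ℝ x q.1 : ℝ) : ℂ) * Complex.I) • g (x, q.2)) ?_
  apply Continuous.stronglyMeasurable
  have := g.continuous
  simp only [Function.uncurry_def]
  fun_prop

theorem lintegral_sq_eq_of_norm_toLp_eq {n : ℕ} (f g : 𝓢(E n, ℂ))
    (h : ‖f.toLp 2 (volume : Measure (E n))‖ = ‖g.toLp 2 (volume : Measure (E n))‖) :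
    ∫⁻ x, ‖f x‖ₑ ^ (2 : ℝ) = ∫⁻ x, ‖g x‖ₑ ^ (2 : ℝ) := by
  rw [SchwartzMap.norm_toLp, SchwartzMap.norm_toLp] at h
  have h1 : eLpNorm f 2 (volume : Measure (E n)) ≠ ∞ :=
    (SchwartzMap.memLp f 2 (volume : Measure (E n))).2.ne
  have h2 : eLpNorm g 2 (volume : Measure (E n)) ≠ ∞ :=
    (SchwartzMap.memLp g 2 (volume : Measure (E n))).2.ne
  have h3 := (ENNReal.toReal_eq_toReal_iff' h1 h2).1 h
  rw [eLpNorm_eq_lintegral_rpow_enorm_toReal two_ne_zero ENNReal.ofNat_ne_top,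
    eLpNorm_eq_lintegral_rpow_enorm_toReal two_ne_zero ENNReal.ofNat_ne_top,
    ENNReal.toReal_ofNat] at h3
  exact ENNReal.rpow_left_injective (by norm_num : (1 / (2 : ℝ)) ≠ 0) h3

theorem lintegral_fourierInv {n : ℕ} (f : 𝓢(E n, ℂ)) :
    ∫⁻ w, ‖(𝓕⁻ f) w‖ₑ ^ (2 : ℝ) = ∫⁻ x, ‖f x‖ₑ ^ (2 : ℝ) := by
  have h := SchwartzMap.norm_fourier_toL2_eq (𝓕⁻ f)
  rw [FourierTransform.fourier_fourierInv_eq] at h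
  exact (lintegral_sq_eq_of_norm_toLp_eq f (𝓕⁻ f) h).symm

theorem eLpNorm_partialFourierInv {n : ℕ} (g : 𝓢(E n × E n, ℂ)) :
    eLpNorm (partialFourierInv g) 2 volume = eLpNorm g 2 volume := by
  rw [eLpNorm_eq_lintegral_rpow_enorm_toReal (by simp) (by simp),
    eLpNorm_eq_lintegral_rpow_enorm_toReal (by simp) (by simp)]
  congr 1
  simp only [ENNReal.toReal_ofNat]
  have hm := (stronglyMeasurable_partialFourierInv g).measurable
  have hg := g.continuous.measurable
  rw [Measure.volume_eq_prod, lintegral_prod_symm' _ (by fun_prop),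
    lintegral_prod_symm' _ (by fun_prop)]
  exact lintegral_congr fun y => lintegral_fourierInv (slice g y)

theorem weylKernelFun_eq_comp {n : ℕ} (g : 𝓢(E n × E n, ℂ)) :
    weylKernelFun g = partialFourierInv g ∘ midDiff n := by
  ext p; exact weylKernelFun_eq g p

theorem eLpNorm_weylKernelFun {n : ℕ} (g : 𝓢(E n × E n, ℂ)) :
    eLpNorm (weylKernelFun g) 2 volume = eLpNorm g 2 volume := by
  rw [weylKernelFun_eq_comp, eLpNorm_comp_measurePreserving
    (stronglyMeasurable_partialFourierInv g).aestronglyMeasurable (measurePreserving_midDiff n),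
    eLpNorm_partialFourierInv]

theorem memLp_weylKernelFun {n : ℕ} (g : 𝓢(E n × E n, ℂ)) :
    MemLp (weylKernelFun g) 2 volume := by
  refine ⟨?_, ?_⟩
  · rw [weylKernelFun_eq_comp]
    exact (stronglyMeasurable_partialFourierInv g).aestronglyMeasurable.comp_measurePreserving
      (measurePreserving_midDiff n)
  · rw [eLpNorm_weylKernelFun]
    exact (SchwartzMap.memLp g 2 (volume : Measure (E n × E n))).2

/-- `g ↦ K_g` on Schwartz functions, as a linear map into `L²(ℝ²ⁿ)`. -/
def weylKernelSchwartz (n : ℕ) : 𝓢(E n × E n, ℂ) →ₗ[ℂ] L2 n where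
  toFun g := (memLp_weylKernelFun g).toLp
  map_add' f g := by
    rw [← MemLp.toLp_add]
    congr 1
    ext p
    have : slice (f + g) (p.2 - p.1) = slice f (p.2 - p.1) + slice g (p.2 - p.1) := rfl
    rw [Pi.add_apply, weylKernelFun_eq, weylKernelFun_eq, weylKernelFun_eq, this,
      FourierTransform.fourierInv_add]
    rfl
  map_smul' c g := by
    rw [RingHom.id_apply, ← MemLp.toLp_const_smul]
    congr 1
    ext p
    have : slice (c • g) (p.2 - p.1) = c • slice g (p.2 - p.1) := rfl
    rw [Pi.smul_apply, weylKernelFun_eq, weylKernelFun_eq, this,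
      FourierTransform.fourierInv_smul]
    rfl

theorem norm_weylKernelSchwartz {n : ℕ} (g : 𝓢(E n × E n, ℂ)) :
    ‖weylKernelSchwartz n g‖ = ‖g.toLp 2 volume‖ := by
  rw [SchwartzMap.norm_toLp]
  simp [weylKernelSchwartz, Lp.norm_toLp, eLpNorm_weylKernelFun]

/-- The map `φ ↦ K_φ` on `L²(ℝ²ⁿ)`: the unique continuous extension of the map given by the
integral formula on the dense subspace of Schwartz functions. -/
def weylKernel (n : ℕ) : L2 n →L[ℂ] L2 n :=
  (weylKernelSchwartz n).extendOfNorm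
    (SchwartzMap.toLpCLM ℂ (E := E n × E n) ℂ 2 (volume : Measure (E n × E n))).toLinearMap

/-- On Schwartz functions the kernel is given by the integral formula. -/
theorem weylKernel_toLp {n : ℕ} (g : 𝓢(E n × E n, ℂ)) :
    weylKernel n (g.toLp 2 (volume : Measure (E n × E n))) = (memLp_weylKernelFun g).toLp := by
  refine LinearMap.extendOfNorm_eq (f := weylKernelSchwartz n)
    (e := (SchwartzMap.toLpCLM ℂ (E := E n × E n) ℂ 2
      (volume : Measure (E n × E n))).toLinearMap) ?_ ⟨1, fun f => ?_⟩ g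
  · exact SchwartzMap.denseRange_toLpCLM ENNReal.ofNat_ne_top
  · rw [one_mul]
    exact (norm_weylKernelSchwartz f).le

/-! ### The Weyl-Zak transform, the bracket and the map `𝒥` -/

/-- The term `(ξ,ξ',η) ↦ K(m+ξ,η) e^{-2πi m·ξ'}`. -/
def zakTermFun {n : ℕ} (m : Fin n → ℤ) (K : E n × E n → ℂ) (q : (E n × E n) × E n) : ℂ :=
  K (intVec m + q.1.1, q.2) *
    Complex.exp (-2 * Real.pi * Complex.I * ((inner ℝ (intVec m) q.1.2 : ℝ) : ℂ))

theorem memLp_zakTermFun {n : ℕ} (m : Fin n → ℤ) (K : L2 n) :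
    MemLp (zakTermFun m K) 2 (zakMeasure n) := by
  have hmp : MeasurePreserving (fun p : E n × E n => (intVec m + p.1, p.2)) volume volume :=
    (measurePreserving_add_left volume (intVec m)).prod (MeasurePreserving.id volume)
  have h1 : MemLp (fun p : E n × E n => K (intVec m + p.1, p.2)) 2
      ((torusMeasure n).prod volume) :=
    ((Lp.memLp K).comp_measurePreserving hmp).mono_measure
      (Measure.prod_mono Measure.restrict_le_self le_rfl)
  have hfst : MeasurePreserving (Prod.fst : E n × E n → E n) (torusMeasure₂ n)
      (torusMeasure n) := measurePreserving_fst
  have h := h1.comp_measurePreserving (hfst.prod (MeasurePreserving.id (volume : Measure (E n))))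
  refine h.of_le (f := zakTermFun m K) (AEStronglyMeasurable.mul h.1 ?_) ?_
  · exact Continuous.aestronglyMeasurable (by fun_prop)
  · refine Filter.Eventually.of_forall fun q => ?_
    have : (-2 * Real.pi * Complex.I * ((inner ℝ (intVec m) q.1.2 : ℝ) : ℂ))
        = Real.pi * Complex.I * ((-2 * inner ℝ (intVec m) q.1.2 : ℝ) : ℂ) := by
      push_cast; ring
    simp only [zakTermFun, norm_mul, this, norm_exp_pi_mul, mul_one]
    rfl

/-- The Weyl-Zak transform `Z_W φ(ξ,ξ',η) = ∑_{m ∈ ℤⁿ} K_φ(m+ξ,η) e^{-2πi m·ξ'}`, an element of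
`L²(𝕋ⁿ × 𝕋ⁿ × ℝⁿ)`. The terms are pairwise orthogonal and their squared norms add up to `‖φ‖²`;
the series converges in `L²`. -/
def weylZak {n : ℕ} (φ : L2 n) : Lp ℂ 2 (zakMeasure n) :=
  ∑' m : Fin n → ℤ, (memLp_zakTermFun m (weylKernel n φ)).toLp

/-- The bracket `[φ,ψ](ξ,ξ') = ∫ Z_W φ(ξ,ξ',η) conj (Z_W ψ(ξ,ξ',η)) dη`. -/
def bracket {n : ℕ} (φ ψ : L2 n) (p : E n × E n) : ℂ :=
  ∫ η : E n, weylZak φ (p, η) * starRingEnd ℂ (weylZak ψ (p, η))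

/-- `Ω_φ = {(ξ,ξ') ∈ 𝕋ⁿ × 𝕋ⁿ : [φ,φ](ξ,ξ') ≠ 0}`. -/
def Omega {n : ℕ} (φ : L2 n) : Set (E n × E n) :=
  {p | p ∈ cube n ×ˢ cube n ∧ bracket φ φ p ≠ 0}

open Classical in
/-- `𝒥φ(ξ,ξ') = Z_W φ(ξ,ξ',·)`, an element of `L²(ℝⁿ)` for a.e. `(ξ,ξ')` (and `0` on the
exceptional null set). -/
def J {n : ℕ} (φ : L2 n) (p : E n × E n) : Lp ℂ 2 (volume : Measure (E n)) :=
  if h : MemLp (fun η : E n => weylZak φ (p, η)) 2 volume then h.toLp else 0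

open Classical in
/-- `𝒥ψ = 𝒥φ / √[φ,φ]` on `Ω_φ` and `𝒥ψ = 0` off `Ω_φ`, almost everywhere on `𝕋ⁿ × 𝕋ⁿ`. -/
def IsNormalization {n : ℕ} (φ ψ : L2 n) : Prop :=
  ∀ᵐ p ∂(torusMeasure₂ n),
    J ψ p = if p ∈ Omega φ then ((Real.sqrt (bracket φ φ p).re : ℂ))⁻¹ • J φ p else 0

end TwistedShift

end

/-! The Weyl-Zak transform is an isometry: the kernel map by Plancherel in one variable, the Zak sum
because the integer tiles partition the space and the phases in ξ' are orthogonal. It turns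
`T^t_{(k,l)}` into multiplication by e^{2πi(k·ξ+l·ξ')}, up to the constant e^{πi k·l}
(`weylZak_twist`). Hence the image of V^t(φ) is the closure of {P · Z_Wφ : P a trigonometric
polynomial}.

By Fubini, u ↦ u · Z_Wφ is isometric on L² of the measure [φ,φ] dξ dξ'. This measure is finite, so
trigonometric polynomials are dense there (`dense_span_torusCharLp`), and the image of V^t(φ) is
exactly {u · Z_Wφ : u ∈ L²([φ,φ])} (`map_principalSpace`).

The function 1/√[φ,φ] on Ω_φ, extended by 0, lies in L²([φ,φ]). So it yields a ψ in V^t(φ), with no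
need for the transform to be onto; injectivity gives uniqueness. If f corresponds to u, then ⟨f,
T^t_{(k,l)}ψ⟩ is, up to a unimodular factor, a Fourier coefficient of u√[φ,φ], whose L² norm is ‖f‖
(`inner_charNormalizer`). Parseval on the torus gives the frame identity, and a Parseval frame spans
a dense subspace of its closed space, so V^t(ψ) = V^t(φ). -/

noncomputable section

namespace TwistedShift

/-! ### Weighted composition operators on `L²` -/

section WeightedComposition

variable {X Y : Type*} [MeasurableSpace X] [MeasurableSpace Y]

/-- The measure `ν` with `∫ |u|² dν = ∫ |w · (u ∘ π)|² dτ`. -/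
def weightedMap (π : Y → X) (w : Y → ℂ) (τ : Measure Y) : Measure X :=
  (τ.withDensity fun y => ‖w y‖ₑ ^ 2).map π

theorem lintegral_weightedMap {π : Y → X} {w : Y → ℂ} {τ : Measure Y} (hπ : Measurable π)
    (hw : Measurable w) {f : X → ℝ≥0∞} (hf : Measurable f) :
    ∫⁻ x, f x ∂weightedMap π w τ = ∫⁻ y, ‖w y‖ₑ ^ 2 * f (π y) ∂τ := by
  rw [weightedMap, lintegral_map hf hπ,
    lintegral_withDensity_eq_lintegral_mul τ (f := fun y => ‖w y‖ₑ ^ 2) (by fun_prop)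
      (g := fun y => f (π y)) (hf.comp hπ)]
  rfl

/-- Where `w` vanishes both products vanish; elsewhere null sets of the density are null for `τ`. So
the weighted composition is well defined on classes even if `π` alone does not pull null sets back
to null sets. -/
theorem ae_eq_mul_comp_of_ae_eq {π : Y → X} {w : Y → ℂ} {τ : Measure Y} (hπ : Measurable π)
    (hw : Measurable w) {u v : X → ℂ} (h : u =ᵐ[weightedMap π w τ] v) :
    (fun y => w y * u (π y)) =ᵐ[τ] fun y => w y * v (π y) := by
  have h1 := ae_of_ae_map hπ.aemeasurable h
  rw [ae_withDensity_iff (by fun_prop)] at h1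
  filter_upwards [h1] with y hy
  by_cases h0 : w y = 0
  · simp [h0]
  · rw [hy (by simpa using h0)]

theorem lintegral_enorm_sq_eq_eLpNorm_sq {μ : Measure X} (f : X → ℂ) :
    ∫⁻ x, ‖f x‖ₑ ^ 2 ∂μ = eLpNorm f 2 μ ^ 2 := by
  have := eLpNorm_nnreal_pow_eq_lintegral (p := 2) (f := f) (μ := μ) two_ne_zero
  simpa using this.symm

theorem eLpNorm_mul_comp {π : Y → X} {w : Y → ℂ} {τ : Measure Y} (hπ : Measurable π)
    (hw : Measurable w) {u : X → ℂ} (hu : Measurable u) :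
    eLpNorm (fun y => w y * u (π y)) 2 τ = eLpNorm u 2 (weightedMap π w τ) := by
  have h : eLpNorm (fun y => w y * u (π y)) 2 τ ^ 2 = eLpNorm u 2 (weightedMap π w τ) ^ 2 := by
    rw [← lintegral_enorm_sq_eq_eLpNorm_sq, ← lintegral_enorm_sq_eq_eLpNorm_sq,
      lintegral_weightedMap hπ hw (by fun_prop)]
    simp [enorm_mul, mul_pow]
  exact (ENNReal.pow_right_strictMono two_ne_zero).injective h

theorem memLp_mul_comp {π : Y → X} {w : Y → ℂ} {τ : Measure Y} {ν : Measure X}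
    (hπ : Measurable π) (hw : Measurable w) (hν : weightedMap π w τ ≤ ν) {u : X → ℂ}
    (hu : MemLp u 2 ν) : MemLp (fun y => w y * u (π y)) 2 τ := by
  have h := hu.mono_measure hν
  -- A strongly measurable representative is needed, since a.e. measurability of `u` does not by
  -- itself pass to `u ∘ π`.
  obtain ⟨v, hv, huv⟩ := h.1
  refine MemLp.ae_eq (ae_eq_mul_comp_of_ae_eq hπ hw huv).symm
    ⟨(hw.mul (hv.measurable.comp hπ)).aestronglyMeasurable, ?_⟩
  rw [eLpNorm_mul_comp hπ hw hv.measurable, ← eLpNorm_congr_ae huv]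
  exact h.2

/-- The operator `u ↦ w · (u ∘ π)` from `L²(ν)` to `L²(τ)`. -/
def weightedComp {π : Y → X} {w : Y → ℂ} {τ : Measure Y} {ν : Measure X}
    (hπ : Measurable π) (hw : Measurable w) (hν : weightedMap π w τ ≤ ν) :
    Lp ℂ 2 ν →L[ℂ] Lp ℂ 2 τ :=
  LinearMap.mkContinuous
    { toFun := fun u => (memLp_mul_comp hπ hw hν (Lp.memLp u)).toLp
      map_add' := fun u v => by
        rw [← MemLp.toLp_add, MemLp.toLp_eq_toLp_iff]
        refine (ae_eq_mul_comp_of_ae_eq hπ hw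
          ((Measure.absolutelyContinuous_of_le hν).ae_le (Lp.coeFn_add u v))).trans ?_
        refine Filter.Eventually.of_forall fun y => ?_
        simp [mul_add]
      map_smul' := fun c u => by
        rw [RingHom.id_apply, ← MemLp.toLp_const_smul, MemLp.toLp_eq_toLp_iff]
        refine (ae_eq_mul_comp_of_ae_eq hπ hw
          ((Measure.absolutelyContinuous_of_le hν).ae_le (Lp.coeFn_smul c u))).trans ?_
        refine Filter.Eventually.of_forall fun y => ?_
        simp [mul_left_comm] }
    1 fun u => by
      rw [one_mul, LinearMap.coe_mk, AddHom.coe_mk, Lp.norm_toLp, Lp.norm_def,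
        eLpNorm_mul_comp hπ hw (Lp.stronglyMeasurable u).measurable]
      exact ENNReal.toReal_mono (Lp.eLpNorm_ne_top u) (eLpNorm_mono_measure _ hν)

variable {π : Y → X} {w : Y → ℂ} {τ : Measure Y} {ν : Measure X}

theorem weightedComp_apply (hπ : Measurable π) (hw : Measurable w) (hν : weightedMap π w τ ≤ ν)
    (u : Lp ℂ 2 ν) :
    weightedComp hπ hw hν u = (memLp_mul_comp hπ hw hν (Lp.memLp u)).toLp := rfl

theorem coeFn_weightedComp (hπ : Measurable π) (hw : Measurable w) (hν : weightedMap π w τ ≤ ν)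
    (u : Lp ℂ 2 ν) :
    weightedComp hπ hw hν u =ᵐ[τ] fun y => w y * u (π y) :=
  (memLp_mul_comp hπ hw hν (Lp.memLp u)).coeFn_toLp

theorem weightedComp_toLp (hπ : Measurable π) (hw : Measurable w) (hν : weightedMap π w τ ≤ ν)
    {u : X → ℂ} (hu : MemLp u 2 ν) :
    weightedComp hπ hw hν hu.toLp = (memLp_mul_comp hπ hw hν hu).toLp := by
  rw [weightedComp_apply, MemLp.toLp_eq_toLp_iff]
  exact ae_eq_mul_comp_of_ae_eq hπ hw
    ((Measure.absolutelyContinuous_of_le hν).ae_le hu.coeFn_toLp)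

/-- `u ↦ w · (u ∘ π)` as an isometry, in the case where the measures match. -/
def weightedCompₗᵢ (hπ : Measurable π) (hw : Measurable w) (hν : weightedMap π w τ = ν) :
    Lp ℂ 2 ν →ₗᵢ[ℂ] Lp ℂ 2 τ where
  toLinearMap := (weightedComp hπ hw hν.le).toLinearMap
  norm_map' u := by
    change ‖weightedComp hπ hw hν.le u‖ = ‖u‖
    rw [weightedComp_apply, Lp.norm_toLp, Lp.norm_def,
      eLpNorm_mul_comp hπ hw (Lp.stronglyMeasurable u).measurable, hν]

theorem weightedCompₗᵢ_apply (hπ : Measurable π) (hw : Measurable w)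
    (hν : weightedMap π w τ = ν) (u : Lp ℂ 2 ν) :
    weightedCompₗᵢ hπ hw hν u = weightedComp hπ hw hν.le u := rfl

theorem coeFn_weightedCompₗᵢ (hπ : Measurable π) (hw : Measurable w)
    (hν : weightedMap π w τ = ν) (u : Lp ℂ 2 ν) :
    weightedCompₗᵢ hπ hw hν u =ᵐ[τ] fun y => w y * u (π y) :=
  coeFn_weightedComp hπ hw hν.le u

theorem weightedMap_of_norm_eq_one (hp : MeasurePreserving π τ ν) (h : ∀ y, ‖w y‖ = 1) :
    weightedMap π w τ = ν := by
  have : (fun y => ‖w y‖ₑ ^ 2) = 1 := by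
    ext y; simp [← ofReal_norm, h]
  rw [weightedMap, this, withDensity_one, hp.map_eq]

end WeightedComposition

/-! ### Unimodular exponentials -/

/-- `e^{πit}`. -/
def unitExp (t : ℝ) : ℂ := Complex.exp (Real.pi * Complex.I * (t : ℂ))

theorem norm_unitExp (t : ℝ) : ‖unitExp t‖ = 1 := norm_exp_pi_mul t

theorem unitExp_ne_zero (t : ℝ) : unitExp t ≠ 0 := Complex.exp_ne_zero _

theorem unitExp_add (s t : ℝ) : unitExp (s + t) = unitExp s * unitExp t := by
  rw [unitExp, unitExp, unitExp, ← Complex.exp_add]; push_cast; ring_nf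

@[fun_prop]
theorem continuous_unitExp : Continuous unitExp := by unfold unitExp; fun_prop

@[fun_prop]
theorem measurable_unitExp : Measurable unitExp := continuous_unitExp.measurable

theorem unitExp_two_mul_int (m : ℤ) : unitExp (2 * m) = 1 := by
  rw [unitExp, ← Complex.exp_int_mul_two_pi_mul_I m]; push_cast; ring_nf

theorem conj_unitExp (t : ℝ) : starRingEnd ℂ (unitExp t) = unitExp (-t) := by
  rw [unitExp, unitExp, ← Complex.exp_conj]; simp

/-- The k-th derivative is (πi)^k times the function, hence bounded by π^k. This makes the twist
phase a multiplier of Schwartz functions. -/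
theorem hasTemperateGrowth_unitExp : Function.HasTemperateGrowth unitExp := by
  have hd : ∀ k : ℕ, iteratedDeriv k unitExp
      = fun t => (Real.pi * Complex.I) ^ k * unitExp t := by
    intro k
    induction k with
    | zero => simp
    | succ k ih =>
      rw [iteratedDeriv_succ, ih]
      ext t
      have h : HasDerivAt unitExp (unitExp t * (Real.pi * Complex.I * 1)) t :=
        ((Complex.ofRealCLM.hasDerivAt (x := t)).const_mul (Real.pi * Complex.I)).cexp
      rw [(h.const_mul _).deriv]
      ring
  refine ⟨(contDiff_const.mul Complex.ofRealCLM.contDiff).cexp,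
    fun k => ⟨0, Real.pi ^ k, fun t => ?_⟩⟩
  rw [norm_iteratedFDeriv_eq_norm_iteratedDeriv, hd, norm_mul, norm_unitExp]
  simp [abs_of_pos Real.pi_pos]

/-! ### The kernel map is an isometry and intertwines the twisted translations -/

section Kernel

variable {n : ℕ}

theorem norm_weylKernel (φ : L2 n) : ‖weylKernel n φ‖ = ‖φ‖ := by
  have hd : DenseRange (SchwartzMap.toLpCLM ℂ (E := E n × E n) ℂ 2
      (volume : Measure (E n × E n))) := SchwartzMap.denseRange_toLpCLM ENNReal.ofNat_ne_top
  refine hd.induction_on (p := fun φ => ‖weylKernel n φ‖ = ‖φ‖) φ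
    (isClosed_eq (by fun_prop) (by fun_prop)) fun g => ?_
  rw [SchwartzMap.toLpCLM_apply, weylKernel_toLp, ← norm_weylKernelSchwartz]
  rfl

/-- The phase of the twisted translation. -/
def twistPhase (k l : Fin n → ℤ) (p : E n × E n) : ℂ :=
  unitExp (inner ℝ p.1 (intVec l) - inner ℝ p.2 (intVec k))

@[fun_prop]
theorem measurable_twistPhase (k l : Fin n → ℤ) : Measurable (twistPhase k l) := by
  unfold twistPhase; fun_prop

theorem weightedMap_twist (k l : Fin n → ℤ) :
    weightedMap (fun p : E n × E n => (p.1 - intVec k, p.2 - intVec l)) (twistPhase k l) volume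
      = volume :=
  weightedMap_of_norm_eq_one (measurePreserving_sub_right volume (intVec k, intVec l))
    fun _ => norm_unitExp _

/-- The twisted translation as an isometry. -/
def twistₗᵢ (k l : Fin n → ℤ) : L2 n →ₗᵢ[ℂ] L2 n :=
  weightedCompₗᵢ (by fun_prop) (measurable_twistPhase k l) (weightedMap_twist k l)

/-- The phase of the operator on kernels that corresponds to the twisted translation. -/
def kernelPhase (k l : Fin n → ℤ) (p : E n × E n) : ℂ :=
  unitExp (2 * inner ℝ (intVec k) p.1 + inner ℝ (intVec k) (intVec l))

@[fun_prop]
theorem measurable_kernelPhase (k l : Fin n → ℤ) : Measurable (kernelPhase k l) := by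
  unfold kernelPhase; fun_prop

theorem measurePreserving_translate_fst (a : E n) :
    MeasurePreserving (fun p : E n × E n => (a + p.1, p.2)) volume volume :=
  (measurePreserving_add_left volume a).prod (MeasurePreserving.id volume)

/-- The operator `K ↦ e^{πi(2k·ξ + k·l)} K(l + ξ, η)` on kernels. -/
def kernelTranslate (k l : Fin n → ℤ) : L2 n →ₗᵢ[ℂ] L2 n :=
  weightedCompₗᵢ (π := fun p : E n × E n => (intVec l + p.1, p.2)) (by fun_prop)
    (measurable_kernelPhase k l)
    (weightedMap_of_norm_eq_one (measurePreserving_translate_fst _) fun _ => norm_unitExp _)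

theorem coeFn_kernelTranslate (k l : Fin n → ℤ) (K : L2 n) :
    kernelTranslate k l K =ᵐ[volume] fun p => kernelPhase k l p * K (intVec l + p.1, p.2) :=
  coeFn_weightedCompₗᵢ (by fun_prop) (measurable_kernelPhase k l)
    (weightedMap_of_norm_eq_one (measurePreserving_translate_fst _) fun _ => norm_unitExp _) K

/-- Substituting x - k for x and comparing exponents proves this for every `g`: translation
invariance of the Bochner integral needs no integrability. -/
theorem weylKernelFun_twistedTranslateFun (k l : Fin n → ℤ) (g : E n × E n → ℂ)
    (p : E n × E n) :
    weylKernelFun (twistedTranslateFun k l g) p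
      = kernelPhase k l p * weylKernelFun g (intVec l + p.1, p.2) := by
  unfold weylKernelFun
  conv_rhs => rw [← integral_sub_right_eq_self _ (intVec k), ← integral_const_mul]
  refine integral_congr_ae (Filter.Eventually.of_forall fun x => ?_)
  change unitExp _ * g (_, _) * unitExp _ = unitExp _ * (g (_, _) * unitExp _)
  have h : (p.2 - p.1 - intVec l : E n) = p.2 - (intVec l + p.1) := by abel
  rw [h, mul_right_comm, ← unitExp_add, mul_left_comm, ← unitExp_add, mul_comm]
  congr 2
  simp only [inner_sub_left, inner_add_right]
  rw [real_inner_comm (intVec k) p.1, real_inner_comm (intVec k) p.2]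
  ring

/-- Keeps the integral formula for the kernel available after a twisted translation, so that the
intertwining relation can be checked on a dense set. -/
theorem exists_schwartz_twistedTranslateFun (k l : Fin n → ℤ) (g : 𝓢(E n × E n, ℂ)) :
    ∃ g' : 𝓢(E n × E n, ℂ), ⇑g' = twistedTranslateFun k l g := by
  have hL : (fun p : E n × E n => (inner ℝ p.1 (intVec l) - inner ℝ p.2 (intVec k) : ℝ)
      ).HasTemperateGrowth := by
    have := ((innerSL ℝ (intVec l : E n)).comp (ContinuousLinearMap.fst ℝ (E n) (E n))
      - (innerSL ℝ (intVec k : E n)).comp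
        (ContinuousLinearMap.snd ℝ (E n) (E n))).hasTemperateGrowth
    convert this using 2 with p
    simp [real_inner_comm]
  have hw : (twistPhase k l).HasTemperateGrowth := hasTemperateGrowth_unitExp.comp hL
  refine ⟨SchwartzMap.smulLeftCLM ℂ (twistPhase k l)
    (SchwartzMap.compSubConstCLM ℂ ((intVec k, intVec l) : E n × E n) g), ?_⟩
  ext p
  rw [SchwartzMap.smulLeftCLM_apply_apply hw]
  rfl

theorem weylKernel_twist (k l : Fin n → ℤ) (φ : L2 n) :
    weylKernel n (twistₗᵢ k l φ) = kernelTranslate k l (weylKernel n φ) := by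
  have hd : DenseRange (SchwartzMap.toLpCLM ℂ (E := E n × E n) ℂ 2
      (volume : Measure (E n × E n))) := SchwartzMap.denseRange_toLpCLM ENNReal.ofNat_ne_top
  refine hd.induction_on
    (p := fun φ => weylKernel n (twistₗᵢ k l φ) = kernelTranslate k l (weylKernel n φ)) φ
    (isClosed_eq (by fun_prop) (by fun_prop)) fun g => ?_
  obtain ⟨g', hg'⟩ := exists_schwartz_twistedTranslateFun k l g
  have h1 : twistₗᵢ k l (g.toLp 2 (volume : Measure (E n × E n))) = g'.toLp 2 volume := by
    rw [twistₗᵢ, weightedCompₗᵢ_apply, SchwartzMap.toLp, weightedComp_toLp, SchwartzMap.toLp,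
      MemLp.toLp_eq_toLp_iff, hg']
    rfl
  rw [SchwartzMap.toLpCLM_apply, h1, weylKernel_toLp, weylKernel_toLp, kernelTranslate,
    weightedCompₗᵢ_apply, weightedComp_toLp, MemLp.toLp_eq_toLp_iff, hg']
  exact Filter.Eventually.of_forall (weylKernelFun_twistedTranslateFun k l g)

end Kernel

/-! ### The lattice and its fundamental domain -/

section Lattice

variable {n : ℕ}

@[simp]
theorem intVec_apply (k : Fin n → ℤ) (i : Fin n) : intVec k i = (k i : ℝ) := rfl

theorem intVec_add (k l : Fin n → ℤ) : intVec (k + l) = intVec k + intVec l := by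
  ext i; simp

theorem inner_intVec (k : Fin n → ℤ) (x : E n) :
    inner ℝ (intVec k) x = ∑ i, (k i : ℝ) * x i := by
  simp [PiLp.inner_apply, mul_comm]

theorem unitExp_two_mul_inner_intVec (k l : Fin n → ℤ) :
    unitExp (2 * inner ℝ (intVec k) (intVec l)) = 1 := by
  rw [← unitExp_two_mul_int (∑ i, k i * l i), inner_intVec]
  simp

theorem measurableSet_cube : MeasurableSet (cube n) := by
  have : cube n = ⋂ i, {ξ : E n | 0 ≤ ξ i ∧ ξ i < 1} := by ext; simp [cube]
  rw [this]
  refine MeasurableSet.iInter fun i => ?_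
  have hm : Measurable fun ξ : E n => ξ i := by fun_prop
  exact (measurableSet_Ici.preimage hm).inter (measurableSet_Iio.preimage hm)

/-- The set `(m + [0,1)ⁿ) × ℝⁿ`. -/
def tile (m : Fin n → ℤ) : Set (E n × E n) := {p | p.1 - intVec m ∈ cube n}

theorem measurableSet_tile (m : Fin n → ℤ) : MeasurableSet (tile m) :=
  measurableSet_cube.preimage (by fun_prop)

/-- Half-open cubes make the tile index unique, so disjointness and covering hold exactly and not
just up to null sets. -/
theorem mem_tile_iff {m : Fin n → ℤ} {p : E n × E n} :
    p ∈ tile m ↔ m = fun i => ⌊p.1 i⌋ := by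
  have : p ∈ tile m ↔ ∀ i, (m i : ℝ) ≤ p.1 i ∧ p.1 i < m i + 1 := by
    simp [tile, cube, sub_lt_iff_lt_add']
  rw [this, funext_iff]
  exact forall_congr' fun i => by rw [eq_comm, Int.floor_eq_iff]

theorem pairwise_disjoint_tile : Pairwise (Function.onFun Disjoint (tile (n := n))) := by
  intro m m' h
  refine Set.disjoint_left.2 fun p hp hp' => h ?_
  rw [mem_tile_iff.1 hp, mem_tile_iff.1 hp']

theorem iUnion_tile : ⋃ m, tile (n := n) m = Set.univ :=
  Set.eq_univ_of_forall fun _ => Set.mem_iUnion.2 ⟨_, mem_tile_iff.2 rfl⟩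

end Lattice

/-! ### The Zak transform is an isometry -/

section Zak

variable {n : ℕ}

/-- Forgetting ξ' preserves measure because the torus has mass one; what remains is a translation of
the cube. -/
theorem measurePreserving_zak_tile (m : Fin n → ℤ) :
    MeasurePreserving (fun q : (E n × E n) × E n => (intVec m + q.1.1, q.2)) (zakMeasure n)
      (volume.restrict (tile m)) := by
  have h1 : MeasurePreserving (fun q : (E n × E n) × E n => (q.1.1, q.2)) (zakMeasure n)
      ((torusMeasure n).prod volume) :=
    (measurePreserving_fst (μ := torusMeasure n) (ν := torusMeasure n)).prod
      (MeasurePreserving.id (volume : Measure (E n)))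
  have h2 := (measurePreserving_translate_fst (intVec m : E n)).restrict_preimage
    (measurableSet_tile m)
  have h3 : (fun p : E n × E n => (intVec m + p.1, p.2)) ⁻¹' tile m = cube n ×ˢ Set.univ := by
    ext p; simp [tile]
  rw [h3, Measure.volume_eq_prod, ← Measure.prod_restrict, Measure.restrict_univ] at h2
  exact h2.comp h1

/-- The phase `e^{-2πi m·ξ'}`. -/
def zakPhase (m : Fin n → ℤ) (q : (E n × E n) × E n) : ℂ :=
  unitExp (-2 * inner ℝ (intVec m) q.1.2)

@[fun_prop]
theorem measurable_zakPhase (m : Fin n → ℤ) : Measurable (zakPhase m) := by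
  unfold zakPhase; fun_prop

theorem weightedMap_zak (m : Fin n → ℤ) :
    weightedMap (fun q : (E n × E n) × E n => (intVec m + q.1.1, q.2)) (zakPhase m) (zakMeasure n)
      = volume.restrict (tile m) :=
  weightedMap_of_norm_eq_one (measurePreserving_zak_tile m) fun _ => norm_unitExp _

/-- The `m`-th term of the Zak transform, as an operator on `L²`. -/
def zakTerm (m : Fin n → ℤ) : L2 n →L[ℂ] Lp ℂ 2 (zakMeasure n) :=
  weightedComp (by fun_prop) (measurable_zakPhase m)
    ((weightedMap_zak m).le.trans Measure.restrict_le_self)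

theorem coeFn_zakTerm (m : Fin n → ℤ) (K : L2 n) :
    zakTerm m K =ᵐ[zakMeasure n] fun q => zakPhase m q * K (intVec m + q.1.1, q.2) :=
  coeFn_weightedComp (by fun_prop) (measurable_zakPhase m)
    ((weightedMap_zak m).le.trans Measure.restrict_le_self) K

theorem toLp_zakTermFun (m : Fin n → ℤ) (K : L2 n) :
    (memLp_zakTermFun m K).toLp = zakTerm m K := by
  rw [zakTerm, weightedComp_apply, MemLp.toLp_eq_toLp_iff]
  refine Filter.Eventually.of_forall fun q => ?_
  dsimp only
  rw [zakTermFun, mul_comm, zakPhase, unitExp]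
  congr 2
  push_cast
  ring

theorem enorm_zakTerm_sq (m : Fin n → ℤ) (K : L2 n) :
    ‖zakTerm m K‖ₑ ^ 2 = ∫⁻ p in tile m, ‖K p‖ₑ ^ 2 := by
  rw [zakTerm, weightedComp_apply, Lp.enorm_toLp,
    eLpNorm_mul_comp _ _ (Lp.stronglyMeasurable K).measurable, weightedMap_zak,
    lintegral_enorm_sq_eq_eLpNorm_sq] <;> fun_prop

theorem hasSum_norm_zakTerm_sq (K : L2 n) :
    HasSum (fun m => ‖zakTerm m K‖ ^ 2) (‖K‖ ^ 2) := by
  have h1 : ∑' m, ‖zakTerm m K‖ₑ ^ 2 = ‖K‖ₑ ^ 2 := by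
    simp_rw [enorm_zakTerm_sq]
    rw [← lintegral_iUnion measurableSet_tile pairwise_disjoint_tile, iUnion_tile,
      Measure.restrict_univ, lintegral_enorm_sq_eq_eLpNorm_sq, Lp.enorm_def]
  have h2 := ENNReal.hasSum_toReal (f := fun m => ‖zakTerm m K‖ₑ ^ 2) (by rw [h1]; simp)
  rw [← ENNReal.tsum_toReal_eq (by simp), h1] at h2
  simpa using h2

/-- The integral factors over coordinates, and a coordinate with m_i ≠ 0 contributes a full-period
integral, which is 0. -/
theorem integral_unitExp_intVec {m : Fin n → ℤ} (hm : m ≠ 0) :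
    ∫ x, unitExp (2 * inner ℝ (intVec m) x) ∂torusMeasure n = 0 := by
  have hs : cube n = (WithLp.ofLp : E n → Fin n → ℝ) ⁻¹'
      (Set.univ.pi fun _ : Fin n => Set.Ico (0 : ℝ) 1) := by
    ext x; simp [cube]
  have hprod : ∀ x : E n, unitExp (2 * inner ℝ (intVec m) x)
      = ∏ i, unitExp (2 * m i * WithLp.ofLp x i) := by
    intro x
    simp only [unitExp]
    rw [← Complex.exp_sum, inner_intVec]
    congr 1
    push_cast
    rw [Finset.mul_sum, Finset.mul_sum]
    exact Finset.sum_congr rfl fun i _ => by ring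
  simp_rw [hprod, torusMeasure]
  rw [hs, (PiLp.volume_preserving_ofLp (Fin n)).setIntegral_preimage_emb
    (MeasurableEquiv.toLp 2 (Fin n → ℝ)).symm.measurableEmbedding
    (fun x : Fin n → ℝ => ∏ i, unitExp (2 * m i * x i)), volume_pi, Measure.restrict_pi_pi,
    integral_fintype_prod_eq_prod (fun i t => unitExp (2 * m i * t))]
  obtain ⟨i, hi⟩ := Function.ne_iff.1 hm
  refine Finset.prod_eq_zero (Finset.mem_univ i) ?_
  rw [integral_Ico_eq_integral_Ioc, ← intervalIntegral.integral_of_le zero_le_one]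
  have hc : (2 * Real.pi * Complex.I * m i : ℂ) ≠ 0 := by
    simp only [ne_eq, mul_eq_zero, Complex.ofReal_eq_zero, Complex.I_ne_zero, Int.cast_eq_zero,
      Real.pi_ne_zero, OfNat.ofNat_ne_zero, or_false, false_or]
    exact hi
  have h1 : ∀ t : ℝ, unitExp (2 * m i * t) = Complex.exp (2 * Real.pi * Complex.I * m i * t) := by
    intro t
    rw [unitExp]
    push_cast
    ring_nf
  simp_rw [h1]
  rw [integral_exp_mul_complex hc, ← h1, ← h1, mul_one, unitExp_two_mul_int]
  simp [unitExp]

/-- The variable ξ' enters only through e^{2πi(m-m')·ξ'}, so the integral splits off a vanishing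
factor. -/
theorem inner_zakTerm_zakTerm {m m' : Fin n → ℤ} (h : m ≠ m') (K K' : L2 n) :
    inner ℂ (zakTerm m K) (zakTerm m' K') = 0 := by
  -- Reorders ((ξ,ξ'),η) as (ξ',(ξ,η)) to expose the product structure.
  have hmp : MeasurePreserving
      (((MeasurableEquiv.prodComm (α := E n) (β := E n)).prodCongr
        (MeasurableEquiv.refl (E n))).trans MeasurableEquiv.prodAssoc) (zakMeasure n)
      ((torusMeasure n).prod ((torusMeasure n).prod volume)) :=
    (measurePreserving_prodAssoc (torusMeasure n) (torusMeasure n) volume).comp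
      ((Measure.measurePreserving_swap (μ := torusMeasure n) (ν := torusMeasure n)).prod
        (MeasurePreserving.id (volume : Measure (E n))))
  have h0 : ∫ x, unitExp (2 * inner ℝ (intVec (m - m')) x) ∂torusMeasure n = 0 :=
    integral_unitExp_intVec (sub_ne_zero.2 h)
  have h1 : inner ℂ (zakTerm m K) (zakTerm m' K')
      = ∫ q : (E n × E n) × E n, unitExp (2 * inner ℝ (intVec (m - m')) q.1.2)
        * (K' (intVec m' + q.1.1, q.2) * starRingEnd ℂ (K (intVec m + q.1.1, q.2)))
          ∂zakMeasure n := by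
    rw [L2.inner_def]
    refine integral_congr_ae ?_
    filter_upwards [coeFn_zakTerm m K, coeFn_zakTerm m' K'] with q h1 h2
    have h3 : 2 * inner ℝ (intVec (m - m')) q.1.2
        = -(-2 * inner ℝ (intVec m) q.1.2) + -2 * inner ℝ (intVec m') q.1.2 := by
      have := intVec_add (m - m') m'
      rw [sub_add_cancel] at this
      rw [this, inner_add_left]
      ring
    rw [h1, h2, h3, unitExp_add, ← conj_unitExp, RCLike.inner_apply, map_mul,
      zakPhase, zakPhase]
    ring
  have h2 := hmp.integral_comp' fun z : E n × (E n × E n) =>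
    unitExp (2 * inner ℝ (intVec (m - m')) z.1)
      * (K' (intVec m' + z.2.1, z.2.2) * starRingEnd ℂ (K (intVec m + z.2.1, z.2.2)))
  rw [integral_prod_mul (μ := torusMeasure n) (ν := (torusMeasure n).prod volume)
    (fun x => unitExp (2 * inner ℝ (intVec (m - m')) x)) (fun z : E n × E n =>
      K' (intVec m' + z.1, z.2) * starRingEnd ℂ (K (intVec m + z.1, z.2))), h0, zero_mul] at h2
  rw [h1]
  exact h2

/-- Passing to the spanned lines gives Pythagoras and the summability criterion for orthogonal
series, also when some terms are zero. -/
theorem orthogonalFamily_zakTerm (K : L2 n) :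
    OrthogonalFamily ℂ (fun m : Fin n → ℤ => (ℂ ∙ zakTerm m K))
      fun m => (ℂ ∙ zakTerm m K).subtypeₗᵢ := by
  intro m m' h v w
  obtain ⟨a, ha⟩ := Submodule.mem_span_singleton.1 v.2
  obtain ⟨b, hb⟩ := Submodule.mem_span_singleton.1 w.2
  simp [← ha, ← hb, inner_smul_left, inner_smul_right, inner_zakTerm_zakTerm h]

theorem summable_zakTerm (K : L2 n) : Summable fun m => zakTerm m K := by
  have h := (orthogonalFamily_zakTerm K).summable_iff_norm_sq_summable
    fun m => ⟨zakTerm m K, Submodule.mem_span_singleton_self _⟩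
  exact h.2 (hasSum_norm_zakTerm_sq K).summable

theorem norm_tsum_zakTerm (K : L2 n) : ‖∑' m, zakTerm m K‖ = ‖K‖ := by
  have h1 : HasSum (fun m => ‖zakTerm m K‖ ^ 2) (‖∑' m, zakTerm m K‖ ^ 2) := by
    refine (((summable_zakTerm K).hasSum.norm).pow 2).congr fun s => ?_
    exact (orthogonalFamily_zakTerm K).norm_sum
      (fun m => ⟨zakTerm m K, Submodule.mem_span_singleton_self _⟩) s
  exact (pow_left_inj₀ (norm_nonneg _) (norm_nonneg _) two_ne_zero).1
    (h1.unique (hasSum_norm_zakTerm_sq K))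

/-- The Zak transform `K ↦ ∑ₘ K(m+ξ,η) e^{-2πi m·ξ'}`. -/
def zakₗᵢ (n : ℕ) : L2 n →ₗᵢ[ℂ] Lp ℂ 2 (zakMeasure n) where
  toFun K := ∑' m, zakTerm m K
  map_add' K K' := by
    simp only [map_add]
    exact (summable_zakTerm K).tsum_add (summable_zakTerm K')
  map_smul' c K := by
    simp only [map_smul, RingHom.id_apply]
    exact (summable_zakTerm K).tsum_const_smul c
  norm_map' K := norm_tsum_zakTerm K

/-- The Weyl-Zak transform as an isometry. -/
def weylZakₗᵢ (n : ℕ) : L2 n →ₗᵢ[ℂ] Lp ℂ 2 (zakMeasure n) :=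
  (zakₗᵢ n).comp ⟨(weylKernel n).toLinearMap, norm_weylKernel⟩

theorem weylZakₗᵢ_apply (φ : L2 n) : weylZakₗᵢ n φ = weylZak φ := by
  simp only [weylZak, toLp_zakTermFun]
  rfl

/-! ### Twisted translations become modulations -/

/-- The character `(ξ,ξ') ↦ e^{2πi(k·ξ + l·ξ')}`. -/
def torusChar (k l : Fin n → ℤ) (p : E n × E n) : ℂ :=
  unitExp (2 * inner ℝ (intVec k) p.1 + 2 * inner ℝ (intVec l) p.2)

@[fun_prop]
theorem continuous_torusChar (k l : Fin n → ℤ) : Continuous (torusChar k l) := by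
  unfold torusChar; fun_prop

@[fun_prop]
theorem measurable_torusChar (k l : Fin n → ℤ) : Measurable (torusChar k l) :=
  (continuous_torusChar k l).measurable

/-- Multiplication by the character `e^{2πi(k·ξ + l·ξ')}`. -/
def modulate (k l : Fin n → ℤ) : Lp ℂ 2 (zakMeasure n) →ₗᵢ[ℂ] Lp ℂ 2 (zakMeasure n) :=
  weightedCompₗᵢ (π := id) (w := fun q => torusChar k l q.1) measurable_id (by fun_prop)
    (weightedMap_of_norm_eq_one (MeasurePreserving.id _) fun _ => norm_unitExp _)

theorem coeFn_modulate (k l : Fin n → ℤ) (F : Lp ℂ 2 (zakMeasure n)) :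
    modulate k l F =ᵐ[zakMeasure n] fun q => torusChar k l q.1 * F q :=
  coeFn_weightedCompₗᵢ measurable_id (by fun_prop)
    (weightedMap_of_norm_eq_one (MeasurePreserving.id _) fun _ => norm_unitExp _) F

theorem zakTerm_kernelTranslate (k l m : Fin n → ℤ) (K : L2 n) :
    zakTerm m (kernelTranslate k l K)
      = unitExp (inner ℝ (intVec k) (intVec l)) • modulate k l (zakTerm (l + m) K) := by
  refine Lp.ext ?_
  have h := ((measurePreserving_zak_tile m).quasiMeasurePreserving.mono_right
    (Measure.absolutelyContinuous_of_le Measure.restrict_le_self)).ae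
      (coeFn_kernelTranslate k l K)
  filter_upwards [coeFn_zakTerm m (kernelTranslate k l K), h, coeFn_zakTerm (l + m) K,
    coeFn_modulate k l (zakTerm (l + m) K),
    Lp.coeFn_smul (unitExp (inner ℝ (intVec k) (intVec l)))
      (modulate k l (zakTerm (l + m) K))] with q h1 h3 h4 h5 h6
  rw [h6, Pi.smul_apply, h5, smul_eq_mul, h1, h3, h4, intVec_add, add_assoc,
    ← mul_assoc, ← mul_assoc, ← mul_assoc]
  congr 1
  simp only [zakPhase, kernelPhase, torusChar]
  -- The two phases differ by e^{2πi k·m}, which is 1 by integrality and is inserted on the right.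
  rw [← unitExp_add, ← unitExp_add, ← unitExp_add, ← mul_one (unitExp (inner ℝ _ _ + _ + _)),
    ← unitExp_two_mul_inner_intVec k m, ← unitExp_add]
  congr 1
  simp only [intVec_add, inner_add_left, inner_add_right]
  ring

theorem weylZak_twist (k l : Fin n → ℤ) (φ : L2 n) :
    weylZakₗᵢ n (twistₗᵢ k l φ)
      = unitExp (inner ℝ (intVec k) (intVec l)) • modulate k l (weylZakₗᵢ n φ) := by
  change ∑' m, zakTerm m (weylKernel n (twistₗᵢ k l φ))
    = _ • modulate k l (∑' m, zakTerm m (weylKernel n φ))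
  have h := summable_zakTerm (weylKernel n φ)
  have h1 : ∑' m, modulate k l (zakTerm (l + m) (weylKernel n φ))
      = modulate k l (∑' m, zakTerm m (weylKernel n φ)) := by
    refine Eq.trans ?_ ((modulate k l).toContinuousLinearMap.hasSum h.hasSum).tsum_eq
    exact (Equiv.addLeft l).tsum_eq fun m => modulate k l (zakTerm m (weylKernel n φ))
  simp_rw [weylKernel_twist, zakTerm_kernelTranslate]
  rw [tsum_const_smul'', h1]

end Zak

/-! ### Characters on the torus -/

section Characters

variable {n : ℕ}

/-- The quotient map onto the torus. -/
def toTorus (p : E n × E n) : UnitAddTorus (Fin n ⊕ Fin n) :=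
  Sum.elim (fun i => (p.1 i : UnitAddCircle)) fun i => (p.2 i : UnitAddCircle)

theorem measurable_toTorus : Measurable (toTorus (n := n)) := by
  refine measurable_pi_lambda _ fun i => ?_
  rcases i with i | i
  · exact AddCircle.measurable_mk'.comp (f := fun p : E n × E n => p.1 i) (by fun_prop)
  · exact AddCircle.measurable_mk'.comp (f := fun p : E n × E n => p.2 i) (by fun_prop)

/-- The section of the quotient map with values in `[0,1)ⁿ × [0,1)ⁿ`. -/
def ofTorus (t : UnitAddTorus (Fin n ⊕ Fin n)) : E n × E n :=
  (WithLp.toLp 2 fun i => (AddCircle.equivIco (1 : ℝ) 0 (t (Sum.inl i)) : ℝ),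
    WithLp.toLp 2 fun i => (AddCircle.equivIco (1 : ℝ) 0 (t (Sum.inr i)) : ℝ))

theorem measurable_ofTorus : Measurable (ofTorus (n := n)) := by
  have h : ∀ j : Fin n ⊕ Fin n, Measurable fun t : UnitAddTorus (Fin n ⊕ Fin n) =>
      (AddCircle.equivIco (1 : ℝ) 0 (t j) : ℝ) := fun j =>
    measurable_subtype_coe.comp
      ((AddCircle.measurableEquivIco (1 : ℝ) 0).measurable.comp (measurable_pi_apply j))
  exact ((MeasurableEquiv.toLp 2 (Fin n → ℝ)).measurable.comp
    (measurable_pi_lambda _ fun i => h (Sum.inl i))).prodMk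
    ((MeasurableEquiv.toLp 2 (Fin n → ℝ)).measurable.comp
    (measurable_pi_lambda _ fun i => h (Sum.inr i)))

theorem ofTorus_toTorus {p : E n × E n} (hp : p ∈ cube n ×ˢ cube n) : ofTorus (toTorus p) = p := by
  refine Prod.ext ?_ ?_
  · ext i
    simp only [ofTorus, toTorus, Sum.elim_inl, AddCircle.coe_equivIco_mk_apply, div_one, mul_one]
    exact Int.fract_eq_self.2 (hp.1 i)
  · ext i
    simp only [ofTorus, toTorus, Sum.elim_inr, AddCircle.coe_equivIco_mk_apply, div_one, mul_one]
    exact Int.fract_eq_self.2 (hp.2 i)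

theorem mFourier_toTorus (k l : Fin n → ℤ) (p : E n × E n) :
    UnitAddTorus.mFourier (Sum.elim k l) (toTorus p) = torusChar k l p := by
  simp only [UnitAddTorus.mFourier, ContinuousMap.coe_mk, Fintype.prod_sum_type, Sum.elim_inl,
    Sum.elim_inr, toTorus, fourier_coe_apply, torusChar, unitExp]
  rw [← Complex.exp_sum, ← Complex.exp_sum, ← Complex.exp_add, inner_intVec, inner_intVec]
  congr 1
  push_cast
  simp only [Finset.mul_sum, mul_add]
  congr 1 <;> exact Finset.sum_congr rfl fun i _ => by ring

theorem norm_torusChar (k l : Fin n → ℤ) (p : E n × E n) : ‖torusChar k l p‖ = 1 :=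
  norm_unitExp _

theorem memLp_torusChar (μ : Measure (E n × E n)) [IsFiniteMeasure μ] (k l : Fin n → ℤ) :
    MemLp (torusChar k l) 2 μ :=
  MemLp.of_bound (measurable_torusChar k l).aestronglyMeasurable 1
    (Filter.Eventually.of_forall fun p => (norm_torusChar k l p).le)

/-- The characters as elements of `L²(μ)`. -/
def torusCharLp (μ : Measure (E n × E n)) [IsFiniteMeasure μ]
    (kl : (Fin n → ℤ) × (Fin n → ℤ)) : Lp ℂ 2 μ :=
  (memLp_torusChar μ kl.1 kl.2).toLp

/-- On the compact torus the characters span a dense subspace of the continuous functions, which are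
dense in L² of the pushed-forward finite measure. Arbitrary `μ` matters: it is used both for
Lebesgue measure and for [φ,φ] dξ dξ'. -/
theorem dense_span_torusCharLp (μ : Measure (E n × E n)) [IsFiniteMeasure μ]
    (hμ : ∀ᵐ p ∂μ, p ∈ cube n ×ˢ cube n) :
    (Submodule.span ℂ (Set.range (torusCharLp μ))).topologicalClosure = ⊤ := by
  have hid : (fun p => ofTorus (toTorus p)) =ᵐ[μ] id := by
    filter_upwards [hμ] with p hp using ofTorus_toTorus hp
  have h1 : MeasurePreserving toTorus μ (μ.map toTorus) := measurable_toTorus.measurePreserving μ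
  have h2 : MeasurePreserving ofTorus (μ.map toTorus) μ := by
    refine ⟨measurable_ofTorus, ?_⟩
    rw [Measure.map_map measurable_ofTorus measurable_toTorus]
    exact (Measure.map_congr hid).trans Measure.map_id
  have hw1 := weightedMap_of_norm_eq_one (w := fun _ => 1) h1 (by simp)
  have hw2 := weightedMap_of_norm_eq_one (w := fun _ => 1) h2 (by simp)
  set C := weightedCompₗᵢ measurable_toTorus measurable_const hw1
  -- As `μ` lives on the half-open cube, `ofTorus` is a left inverse of the quotient map a.e., so
  -- composing with it gives preimages under `C`.
  have hsurj : Function.Surjective C := by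
    intro f
    refine ⟨weightedCompₗᵢ measurable_ofTorus measurable_const hw2 f, Lp.ext ?_⟩
    have h3 := h1.quasiMeasurePreserving.ae (coeFn_weightedCompₗᵢ measurable_ofTorus
      measurable_const hw2 f)
    filter_upwards [coeFn_weightedCompₗᵢ measurable_toTorus measurable_const hw1
      (weightedCompₗᵢ measurable_ofTorus measurable_const hw2 f), h3, hid] with p h4 h5 h6
    rw [h4, h5, one_mul, one_mul, h6, id]
  let T : C(UnitAddTorus (Fin n ⊕ Fin n), ℂ) →L[ℂ] Lp ℂ 2 μ :=
    C.toContinuousLinearMap.comp (ContinuousMap.toLp 2 (μ.map toTorus) ℂ)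
  have hT : DenseRange T := hsurj.denseRange.comp
    (ContinuousMap.toLp_denseRange ℂ (μ.map toTorus) ℂ (by simp)) C.continuous
  have h := hT.topologicalClosure_map_submodule UnitAddTorus.span_mFourier_closure_eq_top
  rw [Submodule.map_span, ← Set.range_comp] at h
  refine top_le_iff.1 (h.ge.trans (Submodule.topologicalClosure_mono (Submodule.span_mono ?_)))
  rintro _ ⟨j, rfl⟩
  refine ⟨(fun i => j (Sum.inl i), fun i => j (Sum.inr i)), Lp.ext ?_⟩
  have h3 := h1.quasiMeasurePreserving.ae
    (ContinuousMap.coeFn_toLp (p := 2) (𝕜 := ℂ) (μ.map toTorus) (UnitAddTorus.mFourier j))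
  filter_upwards [(memLp_torusChar μ (fun i => j (Sum.inl i)) fun i => j (Sum.inr i)).coeFn_toLp,
    coeFn_weightedCompₗᵢ measurable_toTorus measurable_const hw1
      (ContinuousMap.toLp 2 (μ.map toTorus) ℂ (UnitAddTorus.mFourier j)), h3] with p h4 h5 h6
  refine Eq.trans ?_ h5.symm
  rw [h6, one_mul, torusCharLp, h4, ← mFourier_toTorus]
  congr 2
  ext i
  rcases i with i | i <;> rfl

/-! ### Parseval's identity on the torus -/

theorem ae_mem_cube_prod_cube : ∀ᵐ p ∂torusMeasure₂ n, p ∈ cube n ×ˢ cube n := by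
  rw [torusMeasure₂, torusMeasure, Measure.prod_restrict]
  exact ae_restrict_mem (measurableSet_cube.prod measurableSet_cube)

theorem integral_torusChar (k l : Fin n → ℤ) (h : k ≠ 0 ∨ l ≠ 0) :
    ∫ p, torusChar k l p ∂torusMeasure₂ n = 0 := by
  simp only [torusChar, unitExp_add, torusMeasure₂]
  rw [integral_prod_mul (fun x => unitExp (2 * inner ℝ (intVec k) x))
    fun x => unitExp (2 * inner ℝ (intVec l) x)]
  rcases h with h | h <;> simp [integral_unitExp_intVec h]

theorem orthonormal_torusCharLp : Orthonormal ℂ (torusCharLp (torusMeasure₂ n)) := by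
  have hin : ∀ a b, inner ℂ (torusCharLp (torusMeasure₂ n) a) (torusCharLp (torusMeasure₂ n) b)
      = ∫ p, torusChar (b.1 - a.1) (b.2 - a.2) p ∂torusMeasure₂ n := by
    intro a b
    rw [L2.inner_def]
    refine integral_congr_ae ?_
    filter_upwards [(memLp_torusChar (torusMeasure₂ n) a.1 a.2).coeFn_toLp,
      (memLp_torusChar (torusMeasure₂ n) b.1 b.2).coeFn_toLp] with p h1 h2
    rw [torusCharLp, torusCharLp, h1, h2, RCLike.inner_apply, torusChar, torusChar, conj_unitExp,
      torusChar, ← unitExp_add]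
    have h3 := intVec_add (b.1 - a.1) a.1
    have h4 := intVec_add (b.2 - a.2) a.2
    rw [sub_add_cancel] at h3 h4
    rw [h3, h4, inner_add_left, inner_add_left]
    ring_nf
  rw [orthonormal_iff_ite]
  intro a b
  rw [hin]
  split_ifs with h
  · subst h
    simp [torusChar, inner_intVec, unitExp]
  · refine integral_torusChar _ _ ?_
    by_contra! hc
    exact h (Prod.ext (sub_eq_zero.1 hc.1).symm (sub_eq_zero.1 hc.2).symm)

theorem hasSum_norm_inner_torusCharLp_sq (f : Lp ℂ 2 (torusMeasure₂ n)) :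
    HasSum (fun kl => ‖inner ℂ f (torusCharLp (torusMeasure₂ n) kl)‖ ^ 2) (‖f‖ ^ 2) := by
  have h := (HilbertBasis.mk orthonormal_torusCharLp
    (dense_span_torusCharLp _ ae_mem_cube_prod_cube).ge).hasSum_inner_mul_inner f f
  simp only [HilbertBasis.coe_mk] at h
  have h2 := Complex.hasSum_re h
  rw [inner_self_eq_norm_sq_to_K] at h2
  convert h2 using 1
  · ext kl
    rw [← inner_conj_symm (torusCharLp (torusMeasure₂ n) kl) f, Complex.mul_conj,
      Complex.ofReal_re, Complex.normSq_eq_norm_sq]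
  · norm_cast

end Characters

/-! ### Principal spaces on the Zak side -/

section Normalization

variable {n : ℕ}

/-- `√[φ,φ]`. -/
def sqrtBracket (φ : L2 n) (p : E n × E n) : ℂ := (Real.sqrt (bracket φ φ p).re : ℂ)

open Classical in
/-- `1/√[φ,φ]` on `Ω_φ` and `0` elsewhere. -/
def normalizer (φ : L2 n) (p : E n × E n) : ℂ :=
  if p ∈ Omega φ then (sqrtBracket φ p)⁻¹ else 0

theorem measurable_weylZak (φ : L2 n) : Measurable (weylZak φ) :=
  (Lp.stronglyMeasurable (weylZak φ)).measurable

theorem measurable_bracket (φ : L2 n) : Measurable (bracket φ φ) := by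
  refine (StronglyMeasurable.integral_prod_right
    (f := fun p η => weylZak φ (p, η) * starRingEnd ℂ (weylZak φ (p, η))) ?_).measurable
  exact (Lp.stronglyMeasurable (weylZak φ)).mul
    (RCLike.continuous_conj.comp_stronglyMeasurable (Lp.stronglyMeasurable (weylZak φ)))

theorem measurable_sqrtBracket (φ : L2 n) : Measurable (sqrtBracket φ) := by
  have := measurable_bracket φ
  unfold sqrtBracket
  fun_prop

theorem measurableSet_Omega (φ : L2 n) : MeasurableSet (Omega φ) :=
  (measurableSet_cube.prod measurableSet_cube).inter
    ((measurableSet_singleton (0 : ℂ)).compl.preimage (measurable_bracket φ))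

theorem measurable_normalizer (φ : L2 n) : Measurable (normalizer φ) :=
  Measurable.ite (measurableSet_Omega φ) (measurable_sqrtBracket φ).inv measurable_const

/-- Valid at every point: if the fibre is not square integrable, the Bochner integral and
`ENNReal.toReal ∞` both default to 0. -/
theorem bracket_self_eq (φ : L2 n) (p : E n × E n) :
    bracket φ φ p = ((∫⁻ η, ‖weylZak φ (p, η)‖ₑ ^ 2).toReal : ℂ) := by
  have h : ∀ η, weylZak φ (p, η) * starRingEnd ℂ (weylZak φ (p, η))
      = ((‖weylZak φ (p, η)‖ ^ 2 : ℝ) : ℂ) := fun η => by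
    rw [Complex.mul_conj, Complex.normSq_eq_norm_sq]
  have hm : Measurable fun η => weylZak φ (p, η) :=
    (measurable_weylZak φ).comp measurable_prodMk_left
  simp_rw [bracket, h]
  rw [integral_complex_ofReal, integral_eq_lintegral_of_nonneg_ae
    (Filter.Eventually.of_forall fun η => by positivity)
    (Measurable.aestronglyMeasurable (by fun_prop))]
  congr 3
  ext η
  rw [ENNReal.ofReal_pow (norm_nonneg _), ofReal_norm]

theorem lintegral_weylZak_lt_top (φ : L2 n) :
    ∫⁻ q, ‖weylZak φ q‖ₑ ^ 2 ∂zakMeasure n < ∞ := by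
  rw [lintegral_enorm_sq_eq_eLpNorm_sq]
  exact ENNReal.pow_lt_top (Lp.eLpNorm_lt_top _)

theorem ae_lintegral_weylZak_lt_top (φ : L2 n) :
    ∀ᵐ p ∂torusMeasure₂ n, ∫⁻ η, ‖weylZak φ (p, η)‖ₑ ^ 2 < ∞ := by
  have hm : Measurable fun q => ‖weylZak φ q‖ₑ ^ 2 := (measurable_weylZak φ).enorm.pow_const 2
  refine ae_lt_top hm.lintegral_prod_right' ?_
  rw [← lintegral_prod _ hm.aemeasurable]
  exact (lintegral_weylZak_lt_top φ).ne

theorem ae_enorm_sqrtBracket_sq (φ : L2 n) :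
    ∀ᵐ p ∂torusMeasure₂ n, ‖sqrtBracket φ p‖ₑ ^ 2 = ∫⁻ η, ‖weylZak φ (p, η)‖ₑ ^ 2 := by
  filter_upwards [ae_lintegral_weylZak_lt_top φ] with p hp
  rw [sqrtBracket, bracket_self_eq, Complex.ofReal_re, ← ofReal_norm, Complex.norm_real,
    Real.norm_of_nonneg (Real.sqrt_nonneg _), ← ENNReal.ofReal_pow (Real.sqrt_nonneg _),
    Real.sq_sqrt ENNReal.toReal_nonneg, ENNReal.ofReal_toReal hp.ne]

theorem sqrtBracket_ne_zero_iff {φ : L2 n} {p : E n × E n} :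
    sqrtBracket φ p ≠ 0 ↔ bracket φ φ p ≠ 0 := by
  rw [sqrtBracket, bracket_self_eq, Complex.ofReal_re]
  simp only [ne_eq, Complex.ofReal_eq_zero, Real.sqrt_eq_zero ENNReal.toReal_nonneg]

/-- The inner product of factors is the indicator of Ω_φ, and √[φ,φ] already vanishes on the rest of
the cube. -/
theorem sqrtBracket_mul_sqrtBracket_mul_normalizer {φ : L2 n} {p : E n × E n}
    (hp : p ∈ cube n ×ˢ cube n) :
    sqrtBracket φ p * (sqrtBracket φ p * normalizer φ p) = sqrtBracket φ p := by
  by_cases h : bracket φ φ p = 0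
  · have : sqrtBracket φ p = 0 := not_ne_iff.1 fun h1 => sqrtBracket_ne_zero_iff.1 h1 h
    simp [this]
  · rw [normalizer, if_pos ⟨hp, h⟩, mul_inv_cancel₀ (sqrtBracket_ne_zero_iff.2 h), mul_one]

theorem norm_sqrtBracket_mul_normalizer_le (φ : L2 n) (p : E n × E n) :
    ‖sqrtBracket φ p * normalizer φ p‖ ≤ 1 := by
  unfold normalizer
  split_ifs with h
  · rw [mul_inv_cancel₀ (sqrtBracket_ne_zero_iff.2 h.2), norm_one]
  · simp

/-! ### The weighted space L²([φ,φ]) -/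

/-- The measure `[φ,φ](ξ,ξ') dξ dξ'` on the torus. -/
def bracketMeasure (φ : L2 n) : Measure (E n × E n) :=
  weightedMap Prod.fst (weylZak φ) (zakMeasure n)

theorem weightedMap_weylZak (φ : L2 n) :
    weightedMap Prod.fst (weylZak φ) (zakMeasure n) = bracketMeasure φ := rfl

/-- Integrating |Z_Wφ|² over η first gives [φ,φ]. Thus one weighted space embeds isometrically both
into the Zak side and into L² of the torus. -/
theorem weightedMap_sqrtBracket (φ : L2 n) :
    weightedMap id (sqrtBracket φ) (torusMeasure₂ n) = bracketMeasure φ := by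
  refine Measure.ext_of_lintegral _ fun f hf => ?_
  have hm : Measurable fun q => ‖weylZak φ q‖ₑ ^ 2 := (measurable_weylZak φ).enorm.pow_const 2
  rw [lintegral_weightedMap measurable_id (measurable_sqrtBracket φ) hf, bracketMeasure,
    lintegral_weightedMap measurable_fst (measurable_weylZak φ) hf]
  refine Eq.trans (lintegral_congr_ae ?_)
    (lintegral_prod (μ := torusMeasure₂ n) (ν := volume) (fun q => ‖weylZak φ q‖ₑ ^ 2 * f q.1)
      (hm.mul (hf.comp measurable_fst)).aemeasurable).symm
  filter_upwards [ae_enorm_sqrtBracket_sq φ] with p hp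
  rw [hp, id]
  exact (lintegral_mul_const (f p) (hm.comp (measurable_prodMk_left (x := p)))).symm

instance (φ : L2 n) : IsFiniteMeasure (bracketMeasure φ) := by
  refine ⟨?_⟩
  rw [← lintegral_one, bracketMeasure,
    lintegral_weightedMap measurable_fst (measurable_weylZak φ) measurable_const]
  simpa using lintegral_weylZak_lt_top φ

theorem ae_bracketMeasure (φ : L2 n) :
    ∀ᵐ p ∂bracketMeasure φ, p ∈ cube n ×ˢ cube n := by
  rw [← weightedMap_sqrtBracket, weightedMap, Measure.map_id]
  exact (withDensity_absolutelyContinuous _ _).ae_le ae_mem_cube_prod_cube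

/-- The isometry `u ↦ u · Z_W φ` from `L²([φ,φ])`. -/
def mulZak (φ : L2 n) : Lp ℂ 2 (bracketMeasure φ) →ₗᵢ[ℂ] Lp ℂ 2 (zakMeasure n) :=
  weightedCompₗᵢ measurable_fst (measurable_weylZak φ) (weightedMap_weylZak φ)

theorem mulZak_toLp (φ : L2 n) {u : E n × E n → ℂ} (hu : MemLp u 2 (bracketMeasure φ)) :
    mulZak φ hu.toLp =ᵐ[zakMeasure n] fun q => weylZak φ q * u q.1 := by
  rw [mulZak, weightedCompₗᵢ_apply, weightedComp_toLp]
  exact MemLp.coeFn_toLp _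

/-- The isometry `u ↦ u · √[φ,φ]` from `L²([φ,φ])`. -/
def mulSqrt (φ : L2 n) : Lp ℂ 2 (bracketMeasure φ) →ₗᵢ[ℂ] Lp ℂ 2 (torusMeasure₂ n) :=
  weightedCompₗᵢ measurable_id (measurable_sqrtBracket φ) (weightedMap_sqrtBracket φ)

theorem coeFn_mulSqrt (φ : L2 n) (u : Lp ℂ 2 (bracketMeasure φ)) :
    mulSqrt φ u =ᵐ[torusMeasure₂ n] fun p => sqrtBracket φ p * u p :=
  coeFn_weightedCompₗᵢ measurable_id (measurable_sqrtBracket φ) (weightedMap_sqrtBracket φ) u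

theorem mulSqrt_toLp (φ : L2 n) {u : E n × E n → ℂ} (hu : MemLp u 2 (bracketMeasure φ)) :
    mulSqrt φ hu.toLp =ᵐ[torusMeasure₂ n] fun p => sqrtBracket φ p * u p := by
  rw [mulSqrt, weightedCompₗᵢ_apply, weightedComp_toLp]
  exact MemLp.coeFn_toLp _

/-- The normalizer may be unbounded, but its product with √[φ,φ] is at most 1 in modulus on a
probability space. -/
theorem memLp_char_mul_normalizer (φ : L2 n) (k l : Fin n → ℤ) :
    MemLp (fun p => torusChar k l p * normalizer φ p) 2 (bracketMeasure φ) := by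
  have hm : Measurable fun p => torusChar k l p * normalizer φ p :=
    (measurable_torusChar k l).mul (measurable_normalizer φ)
  refine ⟨hm.aestronglyMeasurable, ?_⟩
  rw [← weightedMap_sqrtBracket, ← eLpNorm_mul_comp measurable_id (measurable_sqrtBracket φ) hm]
  refine (MemLp.of_bound ((measurable_sqrtBracket φ).mul hm).aestronglyMeasurable 1
    (Filter.Eventually.of_forall fun p => ?_)).2
  rw [Pi.mul_apply, mul_left_comm, norm_mul, norm_torusChar, one_mul]
  exact norm_sqrtBracket_mul_normalizer_le φ p

/-- The product of a character and the normalizer, as an element of `L²([φ,φ])`. -/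
def charNormalizer (φ : L2 n) (kl : (Fin n → ℤ) × (Fin n → ℤ)) : Lp ℂ 2 (bracketMeasure φ) :=
  (memLp_char_mul_normalizer φ kl.1 kl.2).toLp

/-! ### The principal space as the range of an isometry -/

theorem modulate_weylZak (φ : L2 n) (k l : Fin n → ℤ) :
    modulate k l (weylZak φ) = mulZak φ (torusCharLp (bracketMeasure φ) (k, l)) := by
  refine Lp.ext ?_
  filter_upwards [coeFn_modulate k l (weylZak φ),
    mulZak_toLp φ (memLp_torusChar (bracketMeasure φ) k l)] with q h1 h2
  rw [h1, torusCharLp, h2, mul_comm]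

/-- An isometry on a complete space is a closed map, so it commutes with closures. -/
theorem topologicalClosure_map_linearIsometry {H₁ H₂ : Type*} [NormedAddCommGroup H₁]
    [NormedAddCommGroup H₂] [NormedSpace ℂ H₁] [NormedSpace ℂ H₂] [CompleteSpace H₁]
    (L : H₁ →ₗᵢ[ℂ] H₂) (s : Submodule ℂ H₁) :
    (s.map L.toLinearMap).topologicalClosure = s.topologicalClosure.map L.toLinearMap :=
  SetLike.coe_injective
    (L.isometry.isClosedEmbedding.isClosedMap.closure_image_eq_of_continuous L.continuous _)

theorem span_range_smul_of_ne_zero {ι V : Type*} [AddCommGroup V] [Module ℂ V] {c : ι → ℂ}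
    (hc : ∀ i, c i ≠ 0) (v : ι → V) :
    Submodule.span ℂ (Set.range fun i => c i • v i) = Submodule.span ℂ (Set.range v) := by
  refine le_antisymm (Submodule.span_le.2 ?_) (Submodule.span_le.2 ?_)
  · rintro _ ⟨i, rfl⟩
    exact Submodule.smul_mem _ _ (Submodule.subset_span ⟨i, rfl⟩)
  · rintro _ ⟨i, rfl⟩
    have := Submodule.smul_mem (Submodule.span ℂ (Set.range fun i => c i • v i)) (c i)⁻¹
      (Submodule.subset_span ⟨i, rfl⟩)
    rwa [smul_smul, inv_mul_cancel₀ (hc i), one_smul] at this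

theorem weylZak_twistedSystem (φ : L2 n) (kl : (Fin n → ℤ) × (Fin n → ℤ)) :
    weylZakₗᵢ n (twistedSystem φ kl)
      = unitExp (inner ℝ (intVec kl.1) (intVec kl.2)) • modulate kl.1 kl.2 (weylZak φ) := by
  rw [← weylZakₗᵢ_apply, ← weylZak_twist]
  rfl

/-- Both sides are the closed span of the characters times Z_Wφ: the unimodular constants do not
change the span, and the characters are dense in L²([φ,φ]). -/
theorem map_principalSpace (φ : L2 n) :
    (principalSpace φ).map (weylZakₗᵢ n).toLinearMap = (mulZak φ).toLinearMap.range := by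
  have h1 : (weylZakₗᵢ n).toLinearMap ∘ twistedSystem φ
      = fun kl : (Fin n → ℤ) × (Fin n → ℤ) => unitExp (inner ℝ (intVec kl.1) (intVec kl.2)) •
        mulZak φ (torusCharLp (bracketMeasure φ) kl) := by
    ext1 kl
    rw [← modulate_weylZak]
    exact weylZak_twistedSystem φ kl
  rw [principalSpace, ← topologicalClosure_map_linearIsometry, Submodule.map_span,
    ← Set.range_comp, h1, span_range_smul_of_ne_zero fun _ => unitExp_ne_zero _,
    LinearMap.range_eq_map, ← dense_span_torusCharLp (bracketMeasure φ) (ae_bracketMeasure φ),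
    ← topologicalClosure_map_linearIsometry, Submodule.map_span, ← Set.range_comp]
  rfl

theorem mem_principalSpace_iff {φ f : L2 n} :
    f ∈ principalSpace φ ↔ ∃ u, mulZak φ u = weylZakₗᵢ n f := by
  have h : f ∈ principalSpace φ
      ↔ weylZakₗᵢ n f ∈ (principalSpace φ).map (weylZakₗᵢ n).toLinearMap :=
    ⟨fun hf => ⟨f, hf, rfl⟩, fun ⟨g, hg, hgf⟩ => (weylZakₗᵢ n).injective hgf ▸ hg⟩
  rw [h, map_principalSpace]
  rfl

/-! ### Normalizations -/

theorem ae_J_eq (φ : L2 n) :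
    ∀ᵐ p ∂torusMeasure₂ n, J φ p =ᵐ[volume] fun η => weylZak φ (p, η) := by
  filter_upwards [ae_lintegral_weylZak_lt_top φ] with p hp
  have h : MemLp (fun η : E n => weylZak φ (p, η)) 2 volume := by
    refine ⟨((measurable_weylZak φ).comp measurable_prodMk_left).aestronglyMeasurable, ?_⟩
    rw [lintegral_enorm_sq_eq_eLpNorm_sq] at hp
    exact lt_top_iff_ne_top.2 fun h => by simp [h] at hp
  rw [J, dif_pos h]
  exact h.coeFn_toLp

open Classical in
-- Equality of almost all fibres in L²(ℝⁿ) is equality a.e. on the product, by Fubini for measurable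
-- null sets.
theorem isNormalization_iff {φ ψ : L2 n} :
    IsNormalization φ ψ ↔
      weylZak ψ =ᵐ[zakMeasure n] fun q => weylZak φ q * normalizer φ q.1 := by
  have hs : MeasurableSet {q : (E n × E n) × E n |
      weylZak ψ q = weylZak φ q * normalizer φ q.1} :=
    measurableSet_eq_fun (measurable_weylZak ψ)
      ((measurable_weylZak φ).mul ((measurable_normalizer φ).comp measurable_fst))
  refine Iff.trans (Filter.eventually_congr ?_)
    (Measure.ae_prod_iff_ae_ae (μ := torusMeasure₂ n) (ν := volume) hs).symm
  filter_upwards [ae_J_eq φ, ae_J_eq ψ] with p hφ hψ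
  have h : (if p ∈ Omega φ then ((Real.sqrt (bracket φ φ p).re : ℂ))⁻¹ • J φ p else 0)
      = normalizer φ p • J φ p := by
    unfold normalizer
    split_ifs
    · rfl
    · rw [zero_smul]
  rw [h, Lp.ext_iff]
  have h2 : ⇑(normalizer φ p • J φ p) =ᵐ[volume] fun η => weylZak φ (p, η) * normalizer φ p := by
    filter_upwards [Lp.coeFn_smul (normalizer φ p) (J φ p), hφ] with η h3 h4
    rw [h3, Pi.smul_apply, h4, smul_eq_mul, mul_comm]
  exact ⟨fun h3 => (hψ.symm.trans h3).trans h2, fun h3 => (hψ.trans h3).trans h2.symm⟩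

theorem exists_isNormalization (φ : L2 n) : ∃ ψ, IsNormalization φ ψ := by
  -- Index 0 is the trivial character, so this is the normalizer times Z_Wφ; lying in the range, it
  -- comes from an element of V^t(φ).
  have h : mulZak φ (charNormalizer φ 0) ∈ (mulZak φ).toLinearMap.range := ⟨_, rfl⟩
  rw [← map_principalSpace] at h
  obtain ⟨ψ, -, hψ⟩ := h
  refine ⟨ψ, isNormalization_iff.2 ?_⟩
  rw [← weylZakₗᵢ_apply]
  have hψ' : weylZakₗᵢ n ψ = mulZak φ (charNormalizer φ 0) := hψ
  rw [hψ']
  filter_upwards [mulZak_toLp φ (memLp_char_mul_normalizer φ 0 0)] with q hq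
  refine hq.trans ?_
  simp [torusChar, inner_intVec, unitExp]

theorem IsNormalization.unique {φ ψ ψ' : L2 n} (h : IsNormalization φ ψ)
    (h' : IsNormalization φ ψ') : ψ = ψ' := by
  refine (weylZakₗᵢ n).injective ?_
  rw [weylZakₗᵢ_apply, weylZakₗᵢ_apply]
  exact Lp.ext ((isNormalization_iff.1 h).trans (isNormalization_iff.1 h').symm)

theorem IsNormalization.weylZak_twistedSystem {φ ψ : L2 n} (h : IsNormalization φ ψ)
    (kl : (Fin n → ℤ) × (Fin n → ℤ)) :
    weylZakₗᵢ n (twistedSystem ψ kl) = mulZak φ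
      (unitExp (inner ℝ (intVec kl.1) (intVec kl.2)) • charNormalizer φ kl) := by
  rw [TwistedShift.weylZak_twistedSystem, map_smul]
  congr 1
  refine Lp.ext ?_
  filter_upwards [coeFn_modulate kl.1 kl.2 (weylZak ψ), isNormalization_iff.1 h,
    mulZak_toLp φ (memLp_char_mul_normalizer φ kl.1 kl.2)] with q h1 h2 h3
  rw [h1, h2, charNormalizer, h3]
  ring

/-- Of the two factors √[φ,φ] in the weight, one cancels against the normalizer and the other stays
with `u`. -/
theorem inner_charNormalizer (φ : L2 n) (u : Lp ℂ 2 (bracketMeasure φ))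
    (kl : (Fin n → ℤ) × (Fin n → ℤ)) :
    inner ℂ u (charNormalizer φ kl)
      = inner ℂ (mulSqrt φ u) (torusCharLp (torusMeasure₂ n) kl) := by
  rw [← (mulSqrt φ).inner_map_map, L2.inner_def, L2.inner_def]
  refine integral_congr_ae ?_
  filter_upwards [coeFn_mulSqrt φ u, mulSqrt_toLp φ (memLp_char_mul_normalizer φ kl.1 kl.2),
    (memLp_torusChar (torusMeasure₂ n) kl.1 kl.2).coeFn_toLp, ae_mem_cube_prod_cube]
    with p h1 h2 h3 h4
  rw [h1, charNormalizer, h2, torusCharLp, h3, RCLike.inner_apply, RCLike.inner_apply, map_mul]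
  have h5 : starRingEnd ℂ (sqrtBracket φ p) = sqrtBracket φ p := Complex.conj_ofReal _
  rw [h5]
  linear_combination torusChar kl.1 kl.2 p * starRingEnd ℂ (u p) *
    sqrtBracket_mul_sqrtBracket_mul_normalizer (φ := φ) h4

theorem IsNormalization.isParsevalFrameFor {φ ψ : L2 n} (h : IsNormalization φ ψ) :
    IsParsevalFrameFor (principalSpace φ) (twistedSystem ψ) := by
  refine ⟨fun kl => mem_principalSpace_iff.2 ⟨_, (h.weylZak_twistedSystem kl).symm⟩,
    fun f hf => ?_⟩
  obtain ⟨u, hu⟩ := mem_principalSpace_iff.1 hf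
  have h1 : ‖f‖ = ‖mulSqrt φ u‖ := by
    rw [← (weylZakₗᵢ n).norm_map, ← hu, (mulZak φ).norm_map, (mulSqrt φ).norm_map]
  have h2 : ∀ kl, ‖inner ℂ f (twistedSystem ψ kl)‖
      = ‖inner ℂ (mulSqrt φ u) (torusCharLp (torusMeasure₂ n) kl)‖ := by
    intro kl
    rw [← (weylZakₗᵢ n).inner_map_map, h.weylZak_twistedSystem, ← hu,
      (mulZak φ).inner_map_map, inner_smul_right, norm_mul, norm_unitExp, one_mul,
      inner_charNormalizer]
  simp_rw [h1, h2]
  exact hasSum_norm_inner_torusCharLp_sq _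

/-- The component of a vector of `V` orthogonal to the closed span is again in `V` and has only zero
coefficients, so the Parseval identity gives it norm 0. -/
theorem IsParsevalFrameFor.topologicalClosure_span_eq {ι H : Type*} [NormedAddCommGroup H]
    [InnerProductSpace ℂ H] [CompleteSpace H] {V : Submodule ℂ H} {e : ι → H}
    (h : IsParsevalFrameFor V e) (hV : IsClosed (V : Set H)) :
    (Submodule.span ℂ (Set.range e)).topologicalClosure = V := by
  set W := (Submodule.span ℂ (Set.range e)).topologicalClosure
  have hW : IsClosed (W : Set H) := Submodule.isClosed_topologicalClosure _
  have hWV : W ≤ V := Submodule.topologicalClosure_minimal _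
    (Submodule.span_le.2 (by rintro _ ⟨i, rfl⟩; exact h.1 i)) hV
  refine le_antisymm hWV fun f hf => ?_
  have : CompleteSpace W := hW.completeSpace_coe
  obtain ⟨g, hg, r, hr, rfl⟩ := W.exists_add_mem_mem_orthogonal f
  have hrV : r ∈ V := by simpa using V.sub_mem hf (hWV hg)
  have h0 : ∀ i, inner ℂ r (e i) = 0 := fun i =>
    (Submodule.mem_orthogonal' W r).1 hr _
      (Submodule.le_topologicalClosure _ (Submodule.subset_span ⟨i, rfl⟩))
  have h1 := h.2 r hrV
  simp only [h0, norm_zero, ne_eq, OfNat.ofNat_ne_zero, not_false_eq_true, zero_pow] at h1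
  have h2 : r = 0 := by simpa using h1.unique hasSum_zero
  simpa [h2] using hg

end Normalization

end TwistedShift

end

theorem mainTheorem8 (n : ℕ) (φ : TwistedShift.L2 n) :
    (∃! ψ : TwistedShift.L2 n, TwistedShift.IsNormalization φ ψ) ∧
    ∀ ψ : TwistedShift.L2 n, TwistedShift.IsNormalization φ ψ →
      TwistedShift.IsParsevalFrameFor (TwistedShift.principalSpace φ)
        (TwistedShift.twistedSystem ψ) ∧
      TwistedShift.principalSpace φ = TwistedShift.principalSpace ψ := by
  obtain ⟨ψ, hψ⟩ := TwistedShift.exists_isNormalization φ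
  refine ⟨⟨ψ, hψ, fun ψ' hψ' => hψ'.unique hψ⟩, fun ψ' hψ' => ⟨hψ'.isParsevalFrameFor, ?_⟩⟩
  exact (hψ'.isParsevalFrameFor.topologicalClosure_span_eq
    (Submodule.isClosed_topologicalClosure _)).symm
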